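/- Let $A$ be a unital $C^*$-algebra with state space $\mathcal S(A)$. A *Lipschitz seminorm* on $A$ is a seminorm $L:A\to[0,+\infty]$ such that $L(a^*)=L(a)$ for all $a\in A$, $L(a)=0$ if and only if $a\in\mathbb C\mathbf 1_A$, and $\mathrm{dom}(L)=\{a\in A:L(a)<+\infty\}$ is dense in $A$. A *Lip-norm* is a Lipschitz seminorm $L$ such that the topology induced on $\mathcal S(A)$ by $$\rho_L(\mu,\nu)=\sup\{|\mu(a)-\nu(a)|:a\in A,\ L(a)\le 1\}$$ coincides with the weak$^*$-topology; the pair $(A,L)$ is then called a *compact quantum metric space*. **Theorem.** Let $(A_n,L_n)_{n\ge1}$ be a sequence of compact quantum metric spaces and let $\phi_n:A_n\to A_{n+1}$ be unital $^*$-homomorphisms with $\phi_n(\mathrm{dom}(L_n))\subset\mathrm{dom}(L_{n+1})$ for all $n$. Let $A=\varinjlim(A_n,\phi_n)$ be the $C^*$-algebraic inductive limit, with canonical unital $^*$-homomorphisms $\phi^n:A_n\to A$. For $\mu\in\mathcal S(A)$ put $\mu_n=\mu\circ\phi^n\in\mathcal S(A_n)$, and for $\mu,\nu\in\mathcal S(A)$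 let $$\rho(\mu,\nu)=\sum_{n=1}^\infty\frac1{2^n}\,\frac{\rho_{L_n}(\mu_n,\nu_n)}{1+\rho_{L_n}(\mu_n,\nu_n)}.$$ Define $$L(a)=\sup\left\{\frac{|\mu(a)-\nu(a)|}{\rho(\mu,\nu)}:\mu,\nu\in\mathcal S(A),\ \mu\ne\nu\right\}\in[0,+\infty],\qquad a\in A.$$ Then $L$ is a Lip-norm on $A$; that is, $(A,L)$ is a compact quantum metric space. -/

import Mathlib

open scoped ENNReal ComplexOrder Topology

universe u v

noncomputable section

/-! ### States, Lip-norms -/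

/-- The state space of a unital C⋆-algebra: positive linear functionals `μ` with `μ 1 = 1`.
As a subtype of `WeakDual ℂ A` it carries the weak-⋆ topology. -/
abbrev StateSpace (A : Type u) [CStarAlgebra A] : Type u :=
  {μ : WeakDual ℂ A // μ 1 = 1 ∧ ∀ a : A, 0 ≤ μ (star a * a)}

namespace StateSpace

variable {A : Type u} [CStarAlgebra A] {B : Type v} [CStarAlgebra B]

/-- The weak-⋆ topology on the state space, i.e. the subspace topology from `WeakDual ℂ A`. -/
abbrev weakStar : TopologicalSpace (StateSpace A) := instTopologicalSpaceSubtype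

instance : CoeFun (StateSpace A) (fun _ => A → ℂ) := ⟨fun μ a => μ.1 a⟩

/-- The pull-back `μ ↦ μ ∘ φ` of a state along a unital ⋆-homomorphism. -/
def comap (φ : A →⋆ₐ[ℂ] B) (μ : StateSpace B) : StateSpace A :=
  ⟨(μ.1 : B →L[ℂ] ℂ).comp ⟨φ.toAlgHom.toLinearMap,
    NonUnitalStarAlgHom.instContinuousLinearMapClassComplex.map_continuous φ⟩, by
    refine ⟨?_, fun a => ?_⟩
    · change μ.1 (φ 1) = 1
      rw [map_one]
      exact μ.2.1
    · change 0 ≤ μ.1 (φ (star a * a))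
      rw [map_mul, map_star]
      exact μ.2.2 _⟩

theorem comap_apply (φ : A →⋆ₐ[ℂ] B) (μ : StateSpace B) (a : A) : comap φ μ a = μ (φ a) := rfl

end StateSpace

section LipNorm

variable {A : Type u} [CStarAlgebra A]

/-- A Lipschitz seminorm on a unital C⋆-algebra: a seminorm with values in `[0, ∞]`
(with the convention `0 * ∞ = 0`) that is ⋆-invariant, vanishes exactly on the scalars and
is finite on a dense set. -/
structure IsLipschitzSeminorm (L : A → ℝ≥0∞) : Prop where
  add_le : ∀ a b, L (a + b) ≤ L a + L b
  smul_eq : ∀ (c : ℂ) (a : A), L (c • a) = ‖c‖ₑ * L a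
  star_eq : ∀ a, L (star a) = L a
  eq_zero_iff : ∀ a, L a = 0 ↔ ∃ c : ℂ, a = algebraMap ℂ A c
  dense_dom : Dense {a : A | L a < ∞}

/-- The Monge–Kantorovich distance `ρ_L(μ, ν) = sup {|μ(a) - ν(a)| : L(a) ≤ 1}`, with values in
`[0, ∞]`. -/
def mkDist (L : A → ℝ≥0∞) (μ ν : StateSpace A) : ℝ≥0∞ :=
  ⨆ (a : A) (_ : L a ≤ 1), ‖μ a - ν a‖ₑ

/-- The distance `ρ_L` is an extended pseudometric. -/
abbrev mkPseudoEMetric (L : A → ℝ≥0∞) : PseudoEMetricSpace (StateSpace A) where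
  edist := mkDist L
  edist_self μ := by simp [mkDist]
  edist_comm μ ν := by simp only [mkDist, enorm_sub_rev]
  edist_triangle μ ν κ := by
    refine iSup₂_le fun a ha => ?_
    calc ‖μ a - κ a‖ₑ = ‖(μ a - ν a) + (ν a - κ a)‖ₑ := by rw [sub_add_sub_cancel]
      _ ≤ ‖μ a - ν a‖ₑ + ‖ν a - κ a‖ₑ := enorm_add_le _ _
      _ ≤ mkDist L μ ν + mkDist L ν κ :=
        add_le_add (le_iSup₂ (f := fun (a : A) (_ : L a ≤ 1) => ‖μ a - ν a‖ₑ) a ha)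
          (le_iSup₂ (f := fun (a : A) (_ : L a ≤ 1) => ‖ν a - κ a‖ₑ) a ha)

/-- A Lip-norm is a Lipschitz seminorm for which the topology induced by `ρ_L` on the state
space is the weak-⋆ topology. When `L` is a Lip-norm on `A`, the pair `(A, L)` is called a
compact quantum metric space. -/
structure IsLipNorm (L : A → ℝ≥0∞) : Prop extends IsLipschitzSeminorm L where
  topology_eq :
    (mkPseudoEMetric L).toUniformSpace.toTopologicalSpace = StateSpace.weakStar

end LipNorm

/-! ### The inductive limit of a sequence of unital C⋆-algebras

The limit is the completion of the ⋆-algebra of sequences `(xₙ)` with `xₙ₊₁ = φₙ(xₙ)` for all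
large `n`, with respect to the C⋆-seminorm `lim ‖xₙ‖`. Sequences at seminorm distance zero are
identified by the (Hausdorff) completion. -/

section InductiveLimit

variable {A : ℕ → Type u} [∀ n, CStarAlgebra (A n)] (φ : ∀ n, A n →⋆ₐ[ℂ] A (n + 1))

/-- The unital ⋆-algebra of sequences that are eventually compatible with the connecting maps. -/
def threads : StarSubalgebra ℂ (∀ n, A n) where
  carrier := {x | ∃ N, ∀ n, N ≤ n → x (n + 1) = φ n (x n)}
  mul_mem' := by
    rintro x y ⟨M, hM⟩ ⟨N, hN⟩
    exact ⟨max M N, fun n hn => by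
      simp [hM n (le_of_max_le_left hn), hN n (le_of_max_le_right hn)]⟩
  add_mem' := by
    rintro x y ⟨M, hM⟩ ⟨N, hN⟩
    exact ⟨max M N, fun n hn => by
      simp [hM n (le_of_max_le_left hn), hN n (le_of_max_le_right hn)]⟩
  algebraMap_mem' c := ⟨0, fun n _ => by simp [Pi.algebraMap_apply, AlgHomClass.commutes]⟩
  star_mem' := by
    rintro x ⟨M, hM⟩
    exact ⟨M, fun n hn => by simp [hM n hn, map_star]⟩

/-- A copy of `threads φ`, to carry the seminorm `lim ‖xₙ‖`. -/
def PreLimit : Type u := threads φ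

namespace PreLimit

instance : Ring (PreLimit φ) := inferInstanceAs (Ring (threads φ))
instance : Algebra ℂ (PreLimit φ) := inferInstanceAs (Algebra ℂ (threads φ))
instance : StarRing (PreLimit φ) := inferInstanceAs (StarRing (threads φ))
instance : StarModule ℂ (PreLimit φ) := inferInstanceAs (StarModule ℂ (threads φ))

variable {φ}

theorem exists_tendsto (x : PreLimit φ) :
    ∃ r, Filter.Tendsto (fun n => ‖x.1 n‖) Filter.atTop (𝓝 r) := by
  obtain ⟨N, hN⟩ := x.2
  have h : Antitone fun k => ‖x.1 (k + N)‖ := antitone_nat_of_succ_le fun k => by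
    rw [show k + 1 + N = (k + N) + 1 by omega, hN (k + N) (by omega)]
    exact NonUnitalStarAlgHom.norm_apply_le (φ (k + N)) _
  have hb : BddBelow (Set.range fun k => ‖x.1 (k + N)‖) :=
    ⟨0, by rintro _ ⟨k, rfl⟩; exact norm_nonneg _⟩
  exact ⟨_, (Filter.tendsto_add_atTop_iff_nat N).1 (tendsto_atTop_ciInf h hb)⟩

/-- The limit of `‖xₙ‖`, which exists because `‖xₙ‖` is eventually nonincreasing. -/
def limNorm (x : PreLimit φ) : ℝ := (exists_tendsto x).choose

theorem tendsto_limNorm (x : PreLimit φ) :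
    Filter.Tendsto (fun n => ‖x.1 n‖) Filter.atTop (𝓝 (limNorm x)) :=
  (exists_tendsto x).choose_spec

variable (φ)

/-- The C⋆-seminorm `lim ‖xₙ‖` as a ring seminorm. -/
def ringSeminorm : RingSeminorm (PreLimit φ) where
  toFun := limNorm
  map_zero' := tendsto_nhds_unique (tendsto_limNorm (0 : PreLimit φ))
    (tendsto_const_nhds.congr fun _ => norm_zero.symm)
  add_le' x y := le_of_tendsto_of_tendsto' (tendsto_limNorm (x + y))
    ((tendsto_limNorm x).add (tendsto_limNorm y)) fun n => norm_add_le (x.1 n) (y.1 n)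
  neg' x := tendsto_nhds_unique (tendsto_limNorm (-x))
    ((tendsto_limNorm x).congr fun n => (norm_neg (x.1 n)).symm)
  mul_le' x y := le_of_tendsto_of_tendsto' (tendsto_limNorm (x * y))
    ((tendsto_limNorm x).mul (tendsto_limNorm y)) fun n => norm_mul_le (x.1 n) (y.1 n)

instance : SeminormedRing (PreLimit φ) := (ringSeminorm φ).toSeminormedRing

variable {φ}

theorem tendsto_norm (x : PreLimit φ) :
    Filter.Tendsto (fun n => ‖x.1 n‖) Filter.atTop (𝓝 ‖x‖) :=
  tendsto_limNorm x

instance : NormedAlgebra ℂ (PreLimit φ) where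
  norm_smul_le c x := (tendsto_nhds_unique (tendsto_norm (c • x))
    (((tendsto_norm x).const_mul ‖c‖).congr fun n => (norm_smul c (x.1 n)).symm)).le

instance : NormedStarGroup (PreLimit φ) where
  norm_star_le x := (tendsto_nhds_unique (tendsto_norm (star x))
    ((tendsto_norm x).congr fun n => (norm_star (x.1 n)).symm)).le

theorem norm_mul_self_le (x : PreLimit φ) : ‖x‖ * ‖x‖ ≤ ‖star x * x‖ :=
  (tendsto_nhds_unique (tendsto_norm (star x * x))
    (((tendsto_norm x).mul (tendsto_norm x)).congr fun n =>
      (CStarRing.norm_star_mul_self (x := x.1 n)).symm)).ge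

end PreLimit

/-- The inductive limit `lim (Aₙ, φₙ)` of a sequence of unital C⋆-algebras. -/
def InductiveLimit : Type u := UniformSpace.Completion (PreLimit φ)

namespace InductiveLimit

open UniformSpace

instance : NormedRing (InductiveLimit φ) :=
  inferInstanceAs (NormedRing (Completion (PreLimit φ)))
instance : CompleteSpace (InductiveLimit φ) :=
  inferInstanceAs (CompleteSpace (Completion (PreLimit φ)))
instance : NormedAlgebra ℂ (InductiveLimit φ) where
  __ := (inferInstance : Algebra ℂ (Completion (PreLimit φ)))
  norm_smul_le c x := norm_smul_le (β := Completion (PreLimit φ)) c x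

variable {φ}

/-- The canonical map from eventually compatible sequences to the limit. -/
def of (x : PreLimit φ) : InductiveLimit φ := (x : Completion (PreLimit φ))

theorem denseRange_of : DenseRange (of (φ := φ)) := Completion.denseRange_coe
theorem continuous_of : Continuous (of (φ := φ)) := Completion.continuous_coe _
theorem norm_of (x : PreLimit φ) : ‖of x‖ = ‖x‖ := Completion.norm_coe x
theorem of_add (x y : PreLimit φ) : of (x + y) = of x + of y := Completion.coe_add x y
theorem of_mul (x y : PreLimit φ) : of (x * y) = of x * of y := Completion.coe_mul x y
theorem of_smul (c : ℂ) (x : PreLimit φ) : of (c • x) = c • of x := Completion.coe_smul c x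
theorem of_algebraMap (c : ℂ) : of (algebraMap ℂ (PreLimit φ) c) = algebraMap ℂ _ c := rfl

instance : Star (InductiveLimit φ) :=
  ⟨Completion.map (star : PreLimit φ → PreLimit φ)⟩

theorem of_star (x : PreLimit φ) : of (star x) = star (of x) :=
  (Completion.map_coe (star_isometry (E := PreLimit φ)).uniformContinuous x).symm

theorem continuous_star_limit : Continuous (star : InductiveLimit φ → InductiveLimit φ) :=
  Completion.continuous_map

instance : StarRing (InductiveLimit φ) where
  star_involutive x := by
    refine denseRange_of.induction_on (p := fun x : InductiveLimit φ => star (star x) = x) x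
      (isClosed_eq (continuous_star_limit.comp continuous_star_limit) continuous_id) fun x => ?_
    rw [← of_star, ← of_star, star_star]
  star_mul x y := by
    refine denseRange_of.induction_on₂
      (p := fun x y : InductiveLimit φ => star (x * y) = star y * star x)
      (isClosed_eq (continuous_star_limit.comp continuous_mul)
        ((continuous_star_limit.comp continuous_snd).mul
          (continuous_star_limit.comp continuous_fst))) (fun x y => ?_) x y
    rw [← of_mul, ← of_star, ← of_star, ← of_star, star_mul, of_mul]
  star_add x y := by
    refine denseRange_of.induction_on₂
      (p := fun x y : InductiveLimit φ => star (x + y) = star x + star y)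
      (isClosed_eq (continuous_star_limit.comp continuous_add)
        ((continuous_star_limit.comp continuous_fst).add
          (continuous_star_limit.comp continuous_snd))) (fun x y => ?_) x y
    rw [← of_add, ← of_star, ← of_star, ← of_star, star_add, of_add]

instance : StarModule ℂ (InductiveLimit φ) where
  star_smul c x := by
    refine denseRange_of.induction_on
      (p := fun x : InductiveLimit φ => star (c • x) = star c • star x) x
      (isClosed_eq (continuous_star_limit.comp (continuous_const_smul c))
        (continuous_star_limit.const_smul (star c))) fun x => ?_
    rw [← of_smul, ← of_star, ← of_star, star_smul, of_smul]

instance : CStarRing (InductiveLimit φ) where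
  norm_mul_self_le x := by
    refine denseRange_of.induction_on
      (p := fun x : InductiveLimit φ => ‖x‖ * ‖x‖ ≤ ‖star x * x‖) x
      (isClosed_le (continuous_norm.mul continuous_norm)
        (continuous_norm.comp (continuous_star_limit.mul continuous_id))) fun x => ?_
    rw [← of_star, ← of_mul, norm_of, norm_of]
    exact PreLimit.norm_mul_self_le x

instance : CStarAlgebra (InductiveLimit φ) where

variable (φ)

/-- The sequence `(0, …, 0, a, φₙ(a), φₙ₊₁(φₙ(a)), …)` with `a ∈ Aₙ` at place `n`. -/
def tail (n : ℕ) (a : A n) : ∀ m, A m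
  | 0 => if h : n = 0 then h ▸ a else 0
  | m + 1 => if h : n = m + 1 then h ▸ a else φ m (tail n a m)

theorem tail_self (n : ℕ) (a : A n) : tail φ n a n = a := by
  cases n <;> simp [tail]

theorem tail_succ {n m : ℕ} (h : n ≤ m) (a : A n) :
    tail φ n a (m + 1) = φ m (tail φ n a m) := by
  rw [tail, dif_neg (by omega)]

/-- `tail` as an element of the ⋆-algebra of eventually compatible sequences. -/
def tailThread (n : ℕ) (a : A n) : PreLimit φ := ⟨tail φ n a, n, fun _ hm => tail_succ φ hm a⟩

variable {φ}

theorem of_eq_of_eventually {x y : PreLimit φ} (N : ℕ) (h : ∀ m, N ≤ m → x.1 m = y.1 m) :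
    of x = of y := by
  rw [← sub_eq_zero, ← norm_eq_zero]
  have h1 : of x - of y = of (x - y) := (Completion.coe_sub x y).symm
  rw [h1, norm_of]
  refine tendsto_nhds_unique (PreLimit.tendsto_norm (x - y)) (tendsto_const_nhds.congr' ?_)
  filter_upwards [Filter.eventually_ge_atTop N] with m hm
  change 0 = ‖x.1 m - y.1 m‖
  rw [h m hm, sub_self, norm_zero]

/-- To compare a tail with an eventually compatible sequence it is enough to compare at the
place where the tail starts. -/
theorem of_tailThread_eq {n : ℕ} {a : A n} {x : PreLimit φ}
    (hx : ∀ m, n ≤ m → x.1 (m + 1) = φ m (x.1 m)) (h : x.1 n = a) :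
    of (tailThread φ n a) = of x := by
  refine of_eq_of_eventually n fun m hm => ?_
  change tail φ n a m = x.1 m
  induction m, hm using Nat.le_induction with
  | base => rw [tail_self, h]
  | succ m hm ih => rw [tail_succ φ hm, hx m hm, ih]

variable (φ)

/-- The canonical unital ⋆-homomorphism `φⁿ : Aₙ → lim (Aₙ, φₙ)`. -/
def ι (n : ℕ) : A n →⋆ₐ[ℂ] InductiveLimit φ where
  toFun a := of (tailThread φ n a)
  map_one' := of_tailThread_eq (x := 1) (fun m _ => (map_one (φ m)).symm) rfl
  map_zero' := of_tailThread_eq (x := 0) (fun m _ => (map_zero (φ m)).symm) rfl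
  map_mul' a b := by
    rw [← of_mul]
    refine of_tailThread_eq (fun m hm => ?_) ?_
    · change tail φ n a (m + 1) * tail φ n b (m + 1) = φ m (tail φ n a m * tail φ n b m)
      rw [tail_succ φ hm, tail_succ φ hm, map_mul]
    · change tail φ n a n * tail φ n b n = _
      rw [tail_self, tail_self]
  map_add' a b := by
    rw [← of_add]
    refine of_tailThread_eq (fun m hm => ?_) ?_
    · change tail φ n a (m + 1) + tail φ n b (m + 1) = φ m (tail φ n a m + tail φ n b m)
      rw [tail_succ φ hm, tail_succ φ hm, map_add]
    · change tail φ n a n + tail φ n b n = _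
      rw [tail_self, tail_self]
  commutes' c := by
    rw [← of_algebraMap]
    exact of_tailThread_eq (fun m _ => (AlgHomClass.commutes (φ m) c).symm) rfl
  map_star' a := by
    rw [← of_star]
    refine of_tailThread_eq (fun m hm => ?_) ?_
    · change star (tail φ n a (m + 1)) = φ m (star (tail φ n a m))
      rw [tail_succ φ hm, map_star]
    · change star (tail φ n a n) = _
      rw [tail_self]

theorem ι_apply (n : ℕ) (a : A n) : ι φ n a = of (tailThread φ n a) := rfl

/-- The canonical maps are compatible with the connecting maps. -/
theorem ι_comp (n : ℕ) (a : A n) : ι φ (n + 1) (φ n a) = ι φ n a :=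
  of_tailThread_eq (fun m hm => tail_succ φ (by omega) a)
    ((tail_succ φ le_rfl a).trans (congrArg (φ n) (tail_self φ n a)))

/-- The union of the images of the canonical maps is dense. -/
theorem dense_iUnion_range_ι : Dense (⋃ n, Set.range (ι φ n)) := by
  refine (denseRange_of (φ := φ)).mono ?_
  rintro _ ⟨x, rfl⟩
  obtain ⟨N, hN⟩ := x.2
  exact Set.mem_iUnion.2 ⟨N, x.1 N, of_tailThread_eq hN rfl⟩

/-- The norm on the limit: `‖φⁿ(a)‖ = lim ‖φₘ(⋯ φₙ(a))‖`. -/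
theorem tendsto_norm_ι (n : ℕ) (a : A n) :
    Filter.Tendsto (fun m => ‖tail φ n a m‖) Filter.atTop (𝓝 ‖ι φ n a‖) := by
  rw [ι_apply, norm_of]
  exact PreLimit.tendsto_norm (tailThread φ n a)

end InductiveLimit

/-- `B` with the unital ⋆-homomorphisms `ψₙ : Aₙ → B` is a model of the inductive limit: it is
⋆-isomorphic to `lim (Aₙ, φₙ)` in such a way that `ψₙ` corresponds to the canonical map. -/
def IsInductiveLimit {B : Type v} [CStarAlgebra B] (ψ : ∀ n, A n →⋆ₐ[ℂ] B) : Prop :=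
  ∃ e : InductiveLimit φ ≃⋆ₐ[ℂ] B, ∀ n a, e (InductiveLimit.ι φ n a) = ψ n a

/-- The constructed limit, with its canonical maps, is an inductive limit. -/
theorem isInductiveLimit_ι : IsInductiveLimit φ (InductiveLimit.ι φ) :=
  ⟨StarAlgEquiv.refl ℂ _, fun _ _ => rfl⟩

end InductiveLimit

/-! ### The seminorm on the inductive limit -/

section LimitSeminorm

variable {A : ℕ → Type u} [∀ n, CStarAlgebra (A n)] {B : Type v} [CStarAlgebra B]

/-- The weighted product distance on the state space of the limit `B`, where a state `μ` is
identified with the compatible sequence of states `μₙ = μ ∘ ψₙ`: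
`ρ(μ, ν) = ∑ₙ 2⁻ⁿ ρ_{Lₙ}(μₙ, νₙ) / (1 + ρ_{Lₙ}(μₙ, νₙ))`.
The weights are `1/2, 1/4, …`; the sequence is indexed from `0`. For Lip-norms `Lₙ` all the
distances `ρ_{Lₙ}(μₙ, νₙ)` are finite. -/
def limitDist (L : ∀ n, A n → ℝ≥0∞) (ψ : ∀ n, A n →⋆ₐ[ℂ] B) (μ ν : StateSpace B) : ℝ≥0∞ :=
  ∑' n : ℕ, (2⁻¹ : ℝ≥0∞) ^ (n + 1) *
    (mkDist (L n) (StateSpace.comap (ψ n) μ) (StateSpace.comap (ψ n) ν) /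
      (1 + mkDist (L n) (StateSpace.comap (ψ n) μ) (StateSpace.comap (ψ n) ν)))

/-- The seminorm `L(b) = sup {|μ(b) - ν(b)| / ρ(μ, ν) : μ ≠ ν}`, with values in `[0, ∞]`. -/
def limitSeminorm (L : ∀ n, A n → ℝ≥0∞) (ψ : ∀ n, A n →⋆ₐ[ℂ] B) (b : B) : ℝ≥0∞ :=
  ⨆ (μ : StateSpace B) (ν : StateSpace B) (_ : μ ≠ ν), ‖μ b - ν b‖ₑ / limitDist L ψ μ ν

end LimitSeminorm

end

/-! Write `ρ` for `limitDist`. Its summands are weak-⋆ continuous in one variable, since each `Lₙ`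
is a Lip-norm, and they are dominated by a geometric series, so `ρ(·, ν)` is weak-⋆ continuous
(`continuous_limitDist`). An element with seminorm at most `1` is `1`-Lipschitz for `ρ`, so the
Monge–Kantorovich distance of the limit seminorm is at most `ρ` (`mkDist_limitSeminorm_le`). Hence
its topology is coarser than the weak-⋆ topology. The former is Hausdorff and the latter compact, so
they coincide; no reverse inequality is needed.

Hausdorffness follows from density of the domain. A Lip-norm gives its state space finite diameter,
and on a bounded range `x / (1 + x)` is comparable with `x`, so `ψₙ` maps `dom Lₙ` into the domain
(`limitSeminorm_map_lt_top`); the images of the `ψₙ` have dense union. The seminorm vanishes only on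
scalars because states separate points. -/

namespace StateSpace

variable {A : Type u} [CStarAlgebra A]

/-! ### States are hermitian and contractive, and form a weak-⋆ compact set. -/

theorem apply_algebraMap (μ : StateSpace A) (c : ℂ) : μ.1 (algebraMap ℂ A c) = c := by
  rw [Algebra.algebraMap_eq_smul_one, map_smul, μ.2.1, smul_eq_mul, mul_one]

/-- Polarisation: positivity at `1 + c • a` and at `c • a` makes the cross terms real for every `c`;
`c = 1` settles the imaginary part and `c = I` the real part. -/
theorem apply_star (μ : StateSpace A) (a : A) : μ.1 (star a) = star (μ.1 a) := by
  have h (c : ℂ) : (c * μ.1 a + star c * μ.1 (star a)).im = 0 := by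
    have h1 := μ.2.2 (1 + c • a)
    have h2 := μ.2.2 (c • a)
    have e : star (1 + c • a) * (1 + c • a) =
        1 + c • a + star c • star a + star (c • a) * (c • a) := by
      simp only [star_add, star_one, star_smul]
      simp only [add_mul, mul_add, one_mul, mul_one]
      abel
    rw [e, map_add, map_add, map_add, map_smul, map_smul, μ.2.1] at h1
    have h3 := (Complex.nonneg_iff.1 h1).2
    have h4 := (Complex.nonneg_iff.1 h2).2
    simp only [Complex.add_im, Complex.one_im, smul_eq_mul] at h3 ⊢
    linarith
  have h1 := h 1
  have h2 := h Complex.I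
  simp at h1 h2
  refine Complex.ext ?_ ?_
  · simp; linarith
  · simp; linarith

/-- The variance `μ(a⋆a) - |μ(a)|²` is nonnegative, and `μ(a⋆a) ≤ ‖a‖²` because `‖a‖² - a⋆a` has the
form `c⋆c`. -/
theorem norm_apply_le (μ : StateSpace A) (a : A) : ‖μ.1 a‖ ≤ ‖a‖ := by
  let := CStarAlgebra.spectralOrder A
  have := CStarAlgebra.spectralOrderedRing A
  have h1 : 0 ≤ μ.1 (star (a - algebraMap ℂ A (μ.1 a)) * (a - algebraMap ℂ A (μ.1 a))) := μ.2.2 _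
  have e : star (a - algebraMap ℂ A (μ.1 a)) * (a - algebraMap ℂ A (μ.1 a)) =
      star a * a - star (μ.1 a) • a - μ.1 a • star a + (star (μ.1 a) * μ.1 a) • (1 : A) := by
    simp only [Algebra.algebraMap_eq_smul_one, star_sub, star_smul, star_one, sub_mul, mul_sub,
      smul_mul_assoc, mul_smul_comm, one_mul, mul_one, mul_smul, smul_sub]
    rw [smul_comm (μ.1 a)]
    abel
  rw [e, map_add, map_sub, map_sub, map_smul, map_smul, map_smul, μ.2.1, apply_star] at h1
  obtain ⟨c, hc⟩ : ∃ c : A, algebraMap ℝ A (‖a‖ ^ 2) - star a * a = star c * c := by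
    have h := sub_nonneg.2 (CStarAlgebra.star_mul_le_algebraMap_norm_sq (a := a))
    exact CStarAlgebra.nonneg_iff_eq_star_mul_self.1 h
  have h2 := μ.2.2 c
  rw [← hc, map_sub, IsScalarTower.algebraMap_apply ℝ ℂ A, apply_algebraMap] at h2
  have h3 := (Complex.nonneg_iff.1 h1).1
  have h4 := (Complex.nonneg_iff.1 h2).1
  refine le_of_sq_le_sq ?_ (norm_nonneg a)
  rw [← Complex.normSq_eq_norm_sq, Complex.normSq_apply]
  have h5 : ((‖a‖ ^ 2 : ℝ) : ℂ).re = ‖a‖ ^ 2 := Complex.ofReal_re _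
  simp only [Complex.sub_re, Complex.add_re, smul_eq_mul, Complex.mul_re,
    Complex.star_def, Complex.conj_re, Complex.conj_im, mul_one] at h3 h4
  simp only [Complex.coe_algebraMap] at h4
  linarith

theorem continuous_eval (a : A) : Continuous fun μ : StateSpace A => μ.1 a :=
  (WeakDual.eval_continuous a).comp continuous_subtype_val

/-- Banach–Alaoglu: the states form a weak-⋆ closed subset of the unit ball. -/
instance : CompactSpace (StateSpace A) := by
  have h : IsCompact {μ : WeakDual ℂ A | μ 1 = 1 ∧ ∀ a : A, 0 ≤ μ (star a * a)} := ?_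
  · exact isCompact_iff_compactSpace.1 h
  refine (WeakDual.isCompact_closedBall (𝕜 := ℂ) (0 : StrongDual ℂ A) 1).of_isClosed_subset
    ?_ ?_
  · refine (isClosed_eq (WeakDual.eval_continuous 1) continuous_const).inter ?_
    have : {μ : WeakDual ℂ A | ∀ a : A, 0 ≤ μ (star a * a)} =
        ⋂ a : A, {μ | 0 ≤ μ (star a * a)} := by ext; simp
    change IsClosed {μ : WeakDual ℂ A | ∀ a : A, 0 ≤ μ (star a * a)}
    rw [this]
    exact isClosed_iInter fun a => isClosed_le continuous_const (WeakDual.eval_continuous _)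
  · intro μ hμ
    simp only [Set.mem_preimage, Metric.mem_closedBall, dist_zero_right]
    exact ContinuousLinearMap.opNorm_le_bound _ zero_le_one fun a => by
      rw [one_mul]
      exact norm_apply_le ⟨μ, hμ⟩ a

/-- The convex combination `(1 - t) μ + t ν` of two states. -/
noncomputable def segment (μ ν : StateSpace A) (t : unitInterval) : StateSpace A :=
  ⟨((1 - t : ℝ) : ℂ) • μ.1 + ((t : ℝ) : ℂ) • ν.1, by
    have e (a : A) : (((1 - t : ℝ) : ℂ) • μ.1 + ((t : ℝ) : ℂ) • ν.1) a =
      ((1 - t : ℝ) : ℂ) * μ.1 a + ((t : ℝ) : ℂ) * ν.1 a := rfl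
    refine ⟨?_, fun a => ?_⟩
    · rw [e, μ.2.1, ν.2.1]
      push_cast
      ring
    · rw [e]
      exact add_nonneg (mul_nonneg (Complex.zero_le_real.2 (sub_nonneg.2 t.2.2)) (μ.2.2 a))
        (mul_nonneg (Complex.zero_le_real.2 t.2.1) (ν.2.2 a))⟩

theorem segment_apply (μ ν : StateSpace A) (t : unitInterval) (a : A) :
    (segment μ ν t).1 a = ((1 - t : ℝ) : ℂ) * μ.1 a + ((t : ℝ) : ℂ) * ν.1 a := rfl

theorem segment_zero (μ ν : StateSpace A) : segment μ ν 0 = μ := by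
  refine Subtype.ext (ContinuousLinearMap.ext fun a => ?_)
  change (segment μ ν 0).1 a = μ.1 a
  simp [segment_apply]

theorem continuous_segment (μ ν : StateSpace A) : Continuous (segment μ ν) := by
  refine Continuous.subtype_mk (WeakDual.continuous_of_continuous_eval fun a => ?_) _
  change Continuous fun t => (segment μ ν t).1 a
  simp only [segment_apply]
  fun_prop

theorem continuous_comap {B : Type v} [CStarAlgebra B] (φ : A →⋆ₐ[ℂ] B) :
    Continuous (comap φ) :=
  Continuous.subtype_mk (WeakDual.continuous_of_continuous_eval fun a =>
    continuous_eval (A := B) (φ a)) _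

/-! ### Existence of states, and separation of points. -/

/-- A unital contractive functional is real on self-adjoint elements. -/
theorem im_eq_zero_of_norm_le {g : StrongDual ℂ A} (h1 : g 1 = 1) (hg : ‖g‖ ≤ 1) {h : A}
    (hh : IsSelfAdjoint h) : (g h).im = 0 := by
  -- Compare `|g(h + it)|²` with `‖h + it‖²`: the `t²` terms cancel, leaving `2t · Im g(h)` bounded
  -- in `t`.
  have key (t : ℝ) : ((g h).im + t) ^ 2 ≤ ‖h‖ ^ 2 + t ^ 2 * ‖(1 : A)‖ := by
    have e : star (h + ((t : ℂ) * Complex.I) • (1 : A)) * (h + ((t : ℂ) * Complex.I) • (1 : A)) =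
        h * h + ((t : ℂ) ^ 2) • (1 : A) := by
      have h2 : star ((t : ℂ) * Complex.I) = -((t : ℂ) * Complex.I) := by simp
      have h3 : -((t : ℂ) * Complex.I * ((t : ℂ) * Complex.I)) = (t : ℂ) ^ 2 := by
        linear_combination -(t : ℂ) ^ 2 * Complex.I_mul_I
      rw [star_add, hh.star_eq, star_smul, star_one, h2, ← h3]
      generalize (t : ℂ) * Complex.I = c
      simp only [add_mul, mul_add, smul_mul_assoc, mul_smul_comm, one_mul, mul_one, smul_add,
        smul_smul, neg_smul, neg_mul, smul_neg]
      abel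
    have hle : ‖g (h + ((t : ℂ) * Complex.I) • (1 : A))‖ ≤ ‖h + ((t : ℂ) * Complex.I) • (1 : A)‖ :=
      (g.le_opNorm _).trans (mul_le_of_le_one_left (norm_nonneg _) hg)
    have hn : ‖h + ((t : ℂ) * Complex.I) • (1 : A)‖ ^ 2 ≤ ‖h‖ ^ 2 + t ^ 2 * ‖(1 : A)‖ := by
      rw [sq, ← CStarRing.norm_star_mul_self, e]
      refine (norm_add_le _ _).trans (add_le_add ?_ ?_)
      · rw [sq]; exact norm_mul_le _ _
      · rw [norm_smul]; simp
    have him : (g (h + ((t : ℂ) * Complex.I) • (1 : A))).im = (g h).im + t := by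
      rw [map_add, map_smul, h1]; simp
    calc ((g h).im + t) ^ 2 = |(g (h + ((t : ℂ) * Complex.I) • (1 : A))).im| ^ 2 := by
          rw [him, sq_abs]
      _ ≤ ‖g (h + ((t : ℂ) * Complex.I) • (1 : A))‖ ^ 2 := by
          gcongr; exact Complex.abs_im_le_norm _
      _ ≤ ‖h + ((t : ℂ) * Complex.I) • (1 : A)‖ ^ 2 := by gcongr
      _ ≤ _ := hn
  have hA : ‖(1 : A)‖ = 1 := by
    have : Nontrivial A := ⟨1, 0, fun h => by simp [h] at h1⟩
    exact norm_one
  by_contra hne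
  -- This `t` makes `2t · Im g(h)` equal to `‖h‖² + 1`, exceeding the bound `‖h‖²`.
  have := key ((‖h‖ ^ 2 + 1) / (2 * (g h).im))
  rw [hA] at this
  have e2 : 2 * (g h).im * ((‖h‖ ^ 2 + 1) / (2 * (g h).im)) = ‖h‖ ^ 2 + 1 := by
    field_simp
  nlinarith [sq_nonneg (g h).im]

/-- A unital contractive functional is positive, hence a state. -/
noncomputable def ofNormLe (g : StrongDual ℂ A) (h1 : g 1 = 1) (hg : ‖g‖ ≤ 1) : StateSpace A :=
  ⟨StrongDual.toWeakDual g, h1, fun a => by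
    let := CStarAlgebra.spectralOrder A
    have := CStarAlgebra.spectralOrderedRing A
    change 0 ≤ g (star a * a)
    set y := star a * a with hy
    have hy0 : 0 ≤ y := star_mul_self_nonneg a
    have him := im_eq_zero_of_norm_le h1 hg (IsSelfAdjoint.star_mul_self a)
    refine Complex.nonneg_iff.2 ⟨?_, him.symm⟩
    have hle : y ≤ algebraMap ℝ A ‖y‖ :=
      IsSelfAdjoint.le_algebraMap_norm_self (IsSelfAdjoint.star_mul_self a)
    have hn : ‖algebraMap ℝ A ‖y‖ - y‖ ≤ ‖y‖ :=
      (CStarAlgebra.norm_le_iff_le_algebraMap _ (norm_nonneg y) (sub_nonneg.2 hle)).2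
        (sub_le_self _ hy0)
    have hg' : ‖g (algebraMap ℝ A ‖y‖ - y)‖ ≤ ‖y‖ :=
      ((g.le_opNorm _).trans (mul_le_of_le_one_left (norm_nonneg _) hg)).trans hn
    have hre := (Complex.re_le_norm _).trans hg'
    rw [map_sub, IsScalarTower.algebraMap_apply ℝ ℂ A, Algebra.algebraMap_eq_smul_one, map_smul,
      h1] at hre
    simp only [smul_eq_mul, mul_one, Complex.sub_re, Complex.coe_algebraMap,
      Complex.ofReal_re] at hre
    linarith⟩

/-- A Hahn–Banach functional norming `x` need not be unital, so `z = (‖x‖ + 1) + x` is normed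
instead. As `‖z‖ = 2‖x‖ + 1`, the bounds `|g 1| ≤ 1` and `|g x| ≤ ‖x‖` must both be attained. The
extra `1` keeps the coefficient of `g 1` positive when `x = 0`. -/
theorem exists_apply_eq_norm [Nontrivial A] [PartialOrder A] [StarOrderedRing A] {x : A}
    (hx : 0 ≤ x) : ∃ μ : StateSpace A, μ.1 x = (‖x‖ : ℂ) := by
  set z : A := algebraMap ℝ A (‖x‖ + 1) + x with hz
  have hz0 : 0 ≤ z := add_nonneg (algebraMap_nonneg A (by positivity)) hx
  have hnz : ‖z‖ = 2 * ‖x‖ + 1 := by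
    refine le_antisymm ?_ ?_
    · refine (norm_add_le _ _).trans ?_
      rw [norm_algebraMap', Real.norm_of_nonneg (by positivity)]
      linarith
    · have h1 : ‖x‖ + 1 ≤ ‖z‖ := by
        have := CStarAlgebra.norm_le_norm_of_nonneg_of_le
          (algebraMap_nonneg A (by positivity : 0 ≤ ‖x‖ + 1)) (le_add_of_nonneg_right hx :
            _ ≤ z)
        rwa [norm_algebraMap', Real.norm_of_nonneg (by positivity)] at this
      have h2 : z ≤ algebraMap ℝ A ‖z‖ :=
        IsSelfAdjoint.le_algebraMap_norm_self (IsSelfAdjoint.of_nonneg hz0)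
      have h3 : x ≤ algebraMap ℝ A (‖z‖ - (‖x‖ + 1)) := by
        rw [map_sub]
        exact le_sub_iff_add_le'.2 h2
      have := (CStarAlgebra.norm_le_iff_le_algebraMap x (by linarith) hx).2 h3
      linarith
  obtain ⟨g, hg, hgz⟩ := exists_dual_vector'' ℂ z
  have b1 : ‖g 1‖ ≤ 1 := by
    simpa using (g.le_opNorm 1).trans (mul_le_of_le_one_left (norm_nonneg _) hg)
  have b2 : ‖g x‖ ≤ ‖x‖ := (g.le_opNorm x).trans (mul_le_of_le_one_left (norm_nonneg _) hg)
  have e : ((‖x‖ + 1 : ℝ) : ℂ) * g 1 + g x = ((2 * ‖x‖ + 1 : ℝ) : ℂ) := by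
    rw [← hnz]
    refine Eq.trans ?_ hgz
    rw [hz, map_add, IsScalarTower.algebraMap_apply ℝ ℂ A, Algebra.algebraMap_eq_smul_one,
      map_smul]
    rfl
  have ere := congrArg Complex.re e
  rw [Complex.add_re, Complex.re_ofReal_mul, Complex.ofReal_re] at ere
  have r1 := (Complex.re_le_norm _).trans b1
  have r2 := (Complex.re_le_norm _).trans b2
  have g1re : (g 1).re = 1 := by
    refine le_antisymm r1 ?_
    have := norm_nonneg x
    nlinarith
  have g1 : g 1 = 1 := by
    have : ‖g 1‖ ^ 2 ≤ 1 := pow_le_one₀ (norm_nonneg _) b1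
    rw [← Complex.normSq_eq_norm_sq, Complex.normSq_apply, g1re] at this
    refine Complex.ext g1re ?_
    rw [Complex.one_im]
    nlinarith
  refine ⟨ofNormLe g g1 hg, ?_⟩
  change g x = _
  rw [g1] at e
  push_cast at e
  linear_combination e

/-- If all states kill `k`, a state norming the positive element `‖k‖ + k` shows that its norm is
`‖k‖`, so `‖k‖ + k ≤ ‖k‖` and `k ≤ 0`. This applies to both `h` and `-h`. -/
theorem eq_zero_of_isSelfAdjoint {h : A} (hh : IsSelfAdjoint h) (h0 : ∀ μ : StateSpace A, μ.1 h = 0) :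
    h = 0 := by
  nontriviality A
  let := CStarAlgebra.spectralOrder A
  have := CStarAlgebra.spectralOrderedRing A
  have key {k : A} (hk : IsSelfAdjoint k) (k0 : ∀ μ : StateSpace A, μ.1 k = 0) : k ≤ 0 := by
    have hp : 0 ≤ algebraMap ℝ A ‖k‖ + k := by
      have := IsSelfAdjoint.neg_algebraMap_norm_le_self hk
      simpa [add_comm] using sub_nonneg.2 this
    obtain ⟨μ, hμ⟩ := exists_apply_eq_norm hp
    rw [map_add, k0, IsScalarTower.algebraMap_apply ℝ ℂ A, apply_algebraMap, add_zero] at hμ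
    have hn : ‖k‖ = ‖algebraMap ℝ A ‖k‖ + k‖ := Complex.ofReal_injective hμ
    have := IsSelfAdjoint.le_algebraMap_norm_self (IsSelfAdjoint.of_nonneg hp)
    rw [← hn] at this
    exact (add_le_iff_nonpos_right _).1 this
  refine le_antisymm (key hh h0) ?_
  have := key hh.neg fun μ => by rw [map_neg, h0, neg_zero]
  exact neg_nonpos.1 this

/-- States separate the points of a C⋆-algebra. -/
theorem eq_of_forall_apply_eq {a b : A} (h : ∀ μ : StateSpace A, μ.1 a = μ.1 b) : a = b := by
  rw [← sub_eq_zero]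
  set d := a - b
  have hd (μ : StateSpace A) : μ.1 d = 0 := by rw [map_sub, h, sub_self]
  have h1 : d + star d = 0 := eq_zero_of_isSelfAdjoint (.add_star_self d) fun μ => by
    rw [map_add, apply_star, hd, star_zero, add_zero]
  have h2 : Complex.I • (d - star d) = 0 := by
    refine eq_zero_of_isSelfAdjoint ?_ fun μ => by
      rw [map_smul, map_sub, apply_star, hd, star_zero, sub_zero, smul_zero]
    rw [isSelfAdjoint_iff, star_smul, star_sub, star_star, Complex.star_def, Complex.conj_I,
      neg_smul, ← smul_neg, neg_sub]
  have h3 : d - star d = 0 := (smul_eq_zero.1 h2).resolve_left Complex.I_ne_zero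
  have h4 : (2 : ℂ) • d = 0 := by
    rw [two_smul]
    calc d + d = (d + star d) + (d - star d) := by abel
      _ = 0 := by rw [h1, h3, add_zero]
  exact (smul_eq_zero.1 h4).resolve_left two_ne_zero

end StateSpace

/-! ### Extended metrics and compact topologies. -/

theorem ENNReal.div_one_add_le_one (x : ℝ≥0∞) : x / (1 + x) ≤ 1 :=
  ENNReal.div_le_of_le_mul (by rw [one_mul]; exact le_add_self)

theorem PseudoEMetricSpace.t2Space {X : Type u} [E : PseudoEMetricSpace X]
    (hsep : ∀ {x y : X}, edist x y = 0 → x = y) : T2Space X :=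
  let F : EMetricSpace X := { E with eq_of_edist_eq_zero := hsep }
  (inferInstance : @T2Space X F.toUniformSpace.toTopologicalSpace)

theorem le_nhds_of_tendsto_edist {X : Type u} [PseudoEMetricSpace X] {l : Filter X} {y : X}
    (h : Filter.Tendsto (fun x => edist x y) l (𝓝 0)) : l ≤ 𝓝 y :=
  tendsto_iff_edist_tendsto_0.2 h

/-- The identity is a continuous bijection from a compact to a Hausdorff space. -/
theorem TopologicalSpace.eq_of_le_of_compactSpace_of_t2Space {X : Type u}
    {t s : TopologicalSpace X} (h : t ≤ s) (ht : @CompactSpace X t) (hs : @T2Space X s) : s = t := by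
  obtain ⟨⟨⟨h⟩, -⟩, -⟩ := @Continuous.isClosedEmbedding X X t s ht hs id (continuous_id_iff_le.2 h)
    Function.injective_id
  rw [induced_id] at h
  exact h.symm

/-- A compact topology for which an extended metric is continuous on the diagonal is the topology
of that extended metric. -/
theorem PseudoEMetricSpace.toTopologicalSpace_eq {X : Type u} [t : TopologicalSpace X]
    [CompactSpace X] (E : PseudoEMetricSpace X)
    (hsep : ∀ {x y : X}, E.edist x y = 0 → x = y)
    (hE : ∀ y : X, Filter.Tendsto (fun x => E.edist x y) (@nhds X t y) (𝓝 0)) :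
    E.toUniformSpace.toTopologicalSpace = t :=
  TopologicalSpace.eq_of_le_of_compactSpace_of_t2Space
    (le_of_nhds_le_nhds fun y => @le_nhds_of_tendsto_edist X E _ _ (hE y)) inferInstance
    (@PseudoEMetricSpace.t2Space X E hsep)

theorem continuous_edist_const {X : Type u} [PseudoEMetricSpace X] (y : X) :
    Continuous fun x => edist x y :=
  continuous_id.edist continuous_const

/-! ### The Monge–Kantorovich distance of a Lip-norm. -/

section MkDist

variable {A : Type u} [CStarAlgebra A] {L : A → ℝ≥0∞}

theorem enorm_sub_le_mkDist {a : A} (ha : L a ≤ 1) (μ ν : StateSpace A) :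
    ‖μ.1 a - ν.1 a‖ₑ ≤ mkDist L μ ν :=
  le_iSup₂ (f := fun (a : A) (_ : L a ≤ 1) => ‖μ.1 a - ν.1 a‖ₑ) a ha

theorem IsLipschitzSeminorm.enorm_sub_le_mul_mkDist (hL : IsLipschitzSeminorm L) {a : A}
    (ha : L a < ∞) (μ ν : StateSpace A) : ‖μ.1 a - ν.1 a‖ₑ ≤ L a * mkDist L μ ν := by
  rcases eq_or_ne (L a) 0 with h0 | h0
  · obtain ⟨c, rfl⟩ := (hL.eq_zero_iff a).1 h0
    rw [StateSpace.apply_algebraMap, StateSpace.apply_algebraMap, sub_self, enorm_zero]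
    exact zero_le
  · set r : ℝ := (L a).toReal with hr
    have hr0 : 0 < r := ENNReal.toReal_pos h0 ha.ne
    have hra : ‖(r : ℂ)‖ₑ = L a := by
      rw [← ofReal_norm, Complex.norm_real, Real.norm_of_nonneg hr0.le, hr,
        ENNReal.ofReal_toReal ha.ne]
    have hrne : (r : ℂ) ≠ 0 := Complex.ofReal_ne_zero.2 hr0.ne'
    have h1 : L ((r : ℂ)⁻¹ • a) ≤ 1 := by
      rw [hL.smul_eq, enorm_inv hrne, hra, ENNReal.inv_mul_cancel h0 ha.ne]
    have h2 := enorm_sub_le_mkDist h1 μ ν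
    rw [map_smul, map_smul, ← smul_sub, enorm_smul, enorm_inv hrne, hra] at h2
    calc ‖μ.1 a - ν.1 a‖ₑ = L a * ((L a)⁻¹ * ‖μ.1 a - ν.1 a‖ₑ) := by
          rw [← mul_assoc, ENNReal.mul_inv_cancel h0 ha.ne, one_mul]
      _ ≤ L a * mkDist L μ ν := by gcongr

theorem IsLipschitzSeminorm.eq_of_mkDist_eq_zero (hL : IsLipschitzSeminorm L)
    {μ ν : StateSpace A} (h : mkDist L μ ν = 0) : μ = ν := by
  refine Subtype.ext (DFunLike.coe_injective ?_)
  refine Continuous.ext_on hL.dense_dom (map_continuous μ.1) (map_continuous ν.1) fun a ha => ?_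
  have := hL.enorm_sub_le_mul_mkDist ha μ ν
  rwa [h, mul_zero, nonpos_iff_eq_zero, enorm_eq_zero, sub_eq_zero] at this

theorem IsLipNorm.continuous_mkDist (hL : IsLipNorm L) (ν : StateSpace A) :
    Continuous fun μ => mkDist L μ ν := by
  have h : @Continuous _ _ (mkPseudoEMetric L).toUniformSpace.toTopologicalSpace _
      fun μ : StateSpace A => mkDist L μ ν := @continuous_edist_const _ (mkPseudoEMetric L) ν
  rwa [hL.topology_eq] at h

/-- On the segment from `μ` to `ν` the distance to `μ` is `t` times the full distance. Weak-⋆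
continuity at `t = 0` makes it less than `1` for some `t > 0`, so the full distance is at most `1 /
t`. -/
theorem IsLipNorm.mkDist_ne_top (hL : IsLipNorm L) (μ ν : StateSpace A) : mkDist L μ ν ≠ ∞ := by
  have hc : Continuous fun t => mkDist L (StateSpace.segment μ ν t) μ :=
    (hL.continuous_mkDist μ).comp (StateSpace.continuous_segment μ ν)
  have h0 : mkDist L (StateSpace.segment μ ν 0) μ < 1 := by
    rw [StateSpace.segment_zero]
    exact ((mkPseudoEMetric L).edist_self μ).trans_lt one_pos
  have hev := hc.continuousAt.eventually_lt continuousAt_const h0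
  obtain ⟨t, ht, ht0⟩ : ∃ t : unitInterval, mkDist L (StateSpace.segment μ ν t) μ < 1 ∧ 0 < t := by
    have hne : (𝓝[>] (0 : unitInterval)).NeBot :=
      nhdsGT_neBot_of_exists_gt ⟨1, zero_lt_one⟩
    exact ((hev.filter_mono nhdsWithin_le_nhds).and
      (eventually_mem_nhdsWithin (s := Set.Ioi 0))).exists
  have ht0' : ‖((t : ℝ) : ℂ)‖ₑ ≠ 0 := by
    rw [enorm_ne_zero]
    exact Complex.ofReal_ne_zero.2 (ne_of_gt ht0)
  have hle : mkDist L μ ν ≤ (‖((t : ℝ) : ℂ)‖ₑ)⁻¹ := by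
    refine iSup₂_le fun a ha => ?_
    rw [ENNReal.le_inv_iff_mul_le, mul_comm]
    refine le_trans (le_of_eq ?_) ((enorm_sub_le_mkDist ha _ _).trans ht.le)
    change ‖((t : ℝ) : ℂ)‖ₑ * ‖μ.1 a - ν.1 a‖ₑ = _
    rw [StateSpace.segment_apply, enorm_sub_rev, ← enorm_mul]
    congr 1
    push_cast
    ring
  exact ne_top_of_le_ne_top (ENNReal.inv_ne_top.2 ht0') hle

/-- By compactness the distance to a base state is bounded; the triangle inequality doubles the
bound. -/
theorem IsLipNorm.exists_mkDist_le (hL : IsLipNorm L) :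
    ∃ D : ℝ≥0∞, D ≠ ∞ ∧ ∀ μ ν : StateSpace A, mkDist L μ ν ≤ D := by
  rcases isEmpty_or_nonempty (StateSpace A) with he | ⟨⟨κ⟩⟩
  · exact ⟨0, ENNReal.zero_ne_top, fun μ => (he.false μ).elim⟩
  · obtain ⟨μ₀, -, h⟩ := isCompact_univ.exists_isMaxOn ⟨κ, Set.mem_univ κ⟩
      (hL.continuous_mkDist κ).continuousOn
    have hm (μ : StateSpace A) : mkDist L μ κ ≤ mkDist L μ₀ κ := h (Set.mem_univ μ)
    refine ⟨mkDist L μ₀ κ + mkDist L μ₀ κ,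
      ENNReal.add_ne_top.2 ⟨hL.mkDist_ne_top _ _, hL.mkDist_ne_top _ _⟩, fun μ ν => ?_⟩
    refine ((mkPseudoEMetric L).edist_triangle μ κ ν).trans (add_le_add (hm μ) ?_)
    rw [(mkPseudoEMetric L).edist_comm κ ν]
    exact hm ν

end MkDist

/-! ### The limit distance and its Lipschitz seminorm. -/

section LimitSeminorm

variable {A : ℕ → Type u} [∀ n, CStarAlgebra (A n)] {B : Type v} [CStarAlgebra B]
  {L : ∀ n, A n → ℝ≥0∞} {ψ : ∀ n, A n →⋆ₐ[ℂ] B}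

theorem limitDist_le_one (μ ν : StateSpace B) : limitDist L ψ μ ν ≤ 1 := by
  calc limitDist L ψ μ ν ≤ ∑' n : ℕ, (2⁻¹ : ℝ≥0∞) ^ (n + 1) :=
        ENNReal.tsum_le_tsum fun n => mul_le_of_le_one_right' (ENNReal.div_one_add_le_one _)
    _ = 1 := by
        rw [ENNReal.tsum_geometric_add_one, ENNReal.one_sub_inv_two, inv_inv,
          ENNReal.inv_mul_cancel two_ne_zero ENNReal.ofNat_ne_top]

theorem limitDist_ne_top (μ ν : StateSpace B) : limitDist L ψ μ ν ≠ ∞ :=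
  ne_top_of_le_ne_top ENNReal.one_ne_top (limitDist_le_one μ ν)

theorem limitDist_self (μ : StateSpace B) : limitDist L ψ μ μ = 0 := by
  have h (n : ℕ) : mkDist (L n) (StateSpace.comap (ψ n) μ) (StateSpace.comap (ψ n) μ) = 0 :=
    (mkPseudoEMetric (L n)).edist_self _
  simp only [limitDist, h, ENNReal.zero_div, mul_zero, tsum_zero]

theorem continuous_limitDist (hL : ∀ n, IsLipNorm (L n)) (ν : StateSpace B) :
    Continuous fun μ => limitDist L ψ μ ν := by
  set f : ℕ → StateSpace B → ℝ≥0∞ := fun n μ => (2⁻¹ : ℝ≥0∞) ^ (n + 1) *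
    (mkDist (L n) (StateSpace.comap (ψ n) μ) (StateSpace.comap (ψ n) ν) /
      (1 + mkDist (L n) (StateSpace.comap (ψ n) μ) (StateSpace.comap (ψ n) ν))) with hf
  have hle (n : ℕ) (μ : StateSpace B) : f n μ ≤ (2⁻¹ : ℝ≥0∞) ^ (n + 1) :=
    mul_le_of_le_one_right' (ENNReal.div_one_add_le_one _)
  have htop (n : ℕ) : (2⁻¹ : ℝ≥0∞) ^ (n + 1) ≠ ∞ := by simp
  have hcont (n : ℕ) : Continuous (f n) := by
    have hd : Continuous fun μ : StateSpace B =>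
        mkDist (L n) (StateSpace.comap (ψ n) μ) (StateSpace.comap (ψ n) ν) :=
      ((hL n).continuous_mkDist _).comp (StateSpace.continuous_comap (ψ n))
    refine continuous_iff_continuousAt.2 fun μ => ENNReal.Tendsto.const_mul
      (ENNReal.Tendsto.div hd.continuousAt (.inr (by simp))
        (continuous_const.add hd).continuousAt (.inr ((hL n).mkDist_ne_top _ _)))
      (.inr (htop n))
  -- The Weierstrass M-test is applied to the real-valued series.
  have hr : Continuous fun μ => ∑' n, (f n μ).toReal := by
    refine continuous_tsum (u := fun n => ((2⁻¹ : ℝ≥0∞) ^ (n + 1)).toReal) (fun n => ?_) ?_ ?_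
    · exact ENNReal.continuousOn_toReal.comp_continuous (hcont n) fun μ =>
        ne_top_of_le_ne_top (htop n) (hle n μ)
    · simp only [ENNReal.toReal_pow, ENNReal.toReal_inv, ENNReal.toReal_ofNat]
      exact (summable_nat_add_iff 1).2 (summable_geometric_of_lt_one (by norm_num) (by norm_num))
    · intro n μ
      rw [Real.norm_of_nonneg ENNReal.toReal_nonneg]
      exact ENNReal.toReal_mono (htop n) (hle n μ)
  refine (ENNReal.continuous_ofReal.comp hr).congr fun μ => ?_
  simp only [Function.comp]
  rw [← ENNReal.tsum_toReal_eq fun n => ne_top_of_le_ne_top (htop n) (hle n μ)]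
  exact ENNReal.ofReal_toReal (limitDist_ne_top μ ν)

/-- Boundedness by `D` undoes the truncation: `x = (1 + x) · x / (1 + x)`, where `1 + x ≤ 1 + D` and
the quotient is at most `2 ^ (n + 1)` times the whole sum. -/
theorem mkDist_comap_le (n : ℕ) {D : ℝ≥0∞} (hD : D ≠ ∞)
    (h : ∀ μ ν : StateSpace (A n), mkDist (L n) μ ν ≤ D) (μ ν : StateSpace B) :
    mkDist (L n) (StateSpace.comap (ψ n) μ) (StateSpace.comap (ψ n) ν) ≤
      (1 + D) * 2 ^ (n + 1) * limitDist L ψ μ ν := by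
  set x := mkDist (L n) (StateSpace.comap (ψ n) μ) (StateSpace.comap (ψ n) ν) with hx
  have hxD : x ≤ D := h _ _
  have hterm : (2⁻¹ : ℝ≥0∞) ^ (n + 1) * (x / (1 + x)) ≤ limitDist L ψ μ ν := ENNReal.le_tsum n
  calc x = (1 + x) * (2 ^ (n + 1) * ((2⁻¹ : ℝ≥0∞) ^ (n + 1) * (x / (1 + x)))) := by
        rw [← mul_assoc (2 ^ (n + 1)), ← mul_pow,
          ENNReal.mul_inv_cancel two_ne_zero ENNReal.ofNat_ne_top, one_pow, one_mul,
          ENNReal.mul_div_cancel (by simp)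
            (ENNReal.add_ne_top.2 ⟨ENNReal.one_ne_top, ne_top_of_le_ne_top hD hxD⟩)]
    _ ≤ (1 + D) * (2 ^ (n + 1) * limitDist L ψ μ ν) := by gcongr
    _ = _ := by rw [mul_assoc]

theorem enorm_sub_div_le_limitSeminorm (b : B) {μ ν : StateSpace B} (h : μ ≠ ν) :
    ‖μ.1 b - ν.1 b‖ₑ / limitDist L ψ μ ν ≤ limitSeminorm L ψ b :=
  le_iSup_of_le μ (le_iSup_of_le ν (le_iSup_of_le h le_rfl))

theorem enorm_sub_le_limitSeminorm (b : B) (μ ν : StateSpace B) :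
    ‖μ.1 b - ν.1 b‖ₑ ≤ limitSeminorm L ψ b := by
  rcases eq_or_ne μ ν with rfl | h
  · rw [sub_self, enorm_zero]
    exact zero_le
  · calc ‖μ.1 b - ν.1 b‖ₑ = ‖μ.1 b - ν.1 b‖ₑ / 1 := (div_one _).symm
      _ ≤ ‖μ.1 b - ν.1 b‖ₑ / limitDist L ψ μ ν :=
        ENNReal.div_le_div_left (limitDist_le_one μ ν) _
      _ ≤ _ := enorm_sub_div_le_limitSeminorm b h

theorem mkDist_limitSeminorm_le (μ ν : StateSpace B) :
    mkDist (limitSeminorm L ψ) μ ν ≤ limitDist L ψ μ ν := by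
  refine iSup₂_le fun b hb => ?_
  change ‖μ.1 b - ν.1 b‖ₑ ≤ _
  rcases eq_or_ne μ ν with rfl | h
  · rw [sub_self, enorm_zero]
    exact zero_le
  · have h1 := (enorm_sub_div_le_limitSeminorm b h).trans hb
    -- Separation by `ρ` is not presupposed: if `ρ = 0`, a nonzero numerator would give the quotient
    -- `∞`, contradicting the bound `1`.
    rcases eq_or_ne (limitDist L ψ μ ν) 0 with h0 | h0
    · rw [h0] at h1 ⊢
      by_contra hne
      rw [nonpos_iff_eq_zero] at hne
      rw [ENNReal.div_zero hne] at h1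
      exact absurd h1 (by simp)
    · simpa using (ENNReal.div_le_iff h0 (limitDist_ne_top μ ν)).1 h1

theorem limitSeminorm_map_lt_top (hL : ∀ n, IsLipNorm (L n)) {n : ℕ} {a : A n}
    (ha : L n a < ∞) : limitSeminorm L ψ (ψ n a) < ∞ := by
  obtain ⟨D, hD, h⟩ := (hL n).exists_mkDist_le
  have hK : L n a * ((1 + D) * 2 ^ (n + 1)) < ∞ :=
    ENNReal.mul_lt_top ha (ENNReal.mul_lt_top (ENNReal.add_lt_top.2
      ⟨ENNReal.one_lt_top, hD.lt_top⟩) (ENNReal.pow_lt_top ENNReal.ofNat_lt_top))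
  refine lt_of_le_of_lt (iSup_le fun μ => iSup₂_le fun ν _ => ENNReal.div_le_of_le_mul ?_) hK
  refine ((hL n).enorm_sub_le_mul_mkDist ha (StateSpace.comap (ψ n) μ)
    (StateSpace.comap (ψ n) ν)).trans ?_
  rw [mul_assoc]
  gcongr
  exact mkDist_comap_le n hD h μ ν

theorem IsInductiveLimit.dense_iUnion_range {φ : ∀ n, A n →⋆ₐ[ℂ] A (n + 1)}
    (hψ : IsInductiveLimit φ ψ) : Dense (⋃ n, Set.range (ψ n)) := by
  obtain ⟨e, he⟩ := hψ
  have hc : Continuous e := 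
    NonUnitalStarAlgHom.instContinuousLinearMapClassComplex.map_continuous
      (e : InductiveLimit φ →⋆ₐ[ℂ] B)
  have h := e.surjective.denseRange.dense_image hc (InductiveLimit.dense_iUnion_range_ι φ)
  refine h.mono ?_
  rintro _ ⟨x, hx, rfl⟩
  obtain ⟨n, a, rfl⟩ := Set.mem_iUnion.1 hx
  exact Set.mem_iUnion.2 ⟨n, a, (he n a).symm⟩

theorem isLipschitzSeminorm_limitSeminorm (hL : ∀ n, IsLipNorm (L n))
    (hψ : Dense (⋃ n, Set.range (ψ n))) : IsLipschitzSeminorm (limitSeminorm L ψ) where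
  add_le a b := by
    refine iSup_le fun μ => iSup₂_le fun ν h => ?_
    refine le_trans ?_ (add_le_add (enorm_sub_div_le_limitSeminorm a h)
      (enorm_sub_div_le_limitSeminorm b h))
    rw [← ENNReal.add_div]
    refine ENNReal.div_le_div_right ?_ _
    change ‖μ.1 (a + b) - ν.1 (a + b)‖ₑ ≤ _
    rw [map_add, map_add, add_sub_add_comm]
    exact enorm_add_le _ _
  smul_eq c a := by
    simp only [limitSeminorm, ENNReal.mul_iSup, map_smul, ← smul_sub, enorm_smul, mul_div_assoc]
  star_eq a := by
    have h (μ ν : StateSpace B) : ‖μ.1 (star a) - ν.1 (star a)‖ₑ = ‖μ.1 a - ν.1 a‖ₑ := by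
      rw [StateSpace.apply_star, StateSpace.apply_star, ← star_sub, ← ofReal_norm,
        norm_star, ofReal_norm]
    simp only [limitSeminorm, h]
  eq_zero_iff a := by
    constructor
    · intro h
      have hμν (μ ν : StateSpace B) : μ.1 a = ν.1 a := by
        have := enorm_sub_le_limitSeminorm (L := L) (ψ := ψ) a μ ν
        rwa [h, nonpos_iff_eq_zero, enorm_eq_zero, sub_eq_zero] at this
      rcases isEmpty_or_nonempty (StateSpace B) with he | ⟨⟨κ⟩⟩
      -- Without states, separation of points holds vacuously and forces `a = 0`.
      · exact ⟨0, StateSpace.eq_of_forall_apply_eq fun μ => (he.false μ).elim⟩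
      · refine ⟨κ.1 a, StateSpace.eq_of_forall_apply_eq fun μ => ?_⟩
        rw [StateSpace.apply_algebraMap, hμν μ κ]
    · rintro ⟨c, rfl⟩
      simp [limitSeminorm, StateSpace.apply_algebraMap]
  dense_dom := by
    refine dense_closure.1 (hψ.mono (Set.iUnion_subset fun n => ?_))
    rintro _ ⟨a, rfl⟩
    have hc : Continuous (ψ n) := 
      NonUnitalStarAlgHom.instContinuousLinearMapClassComplex.map_continuous (ψ n)
    exact map_mem_closure hc ((hL n).dense_dom a) fun a ha => limitSeminorm_map_lt_top hL ha

theorem isLipNorm_limitSeminorm (hL : ∀ n, IsLipNorm (L n))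
    (hψ : Dense (⋃ n, Set.range (ψ n))) : IsLipNorm (limitSeminorm L ψ) where
  toIsLipschitzSeminorm := isLipschitzSeminorm_limitSeminorm hL hψ
  topology_eq := by
    refine PseudoEMetricSpace.toTopologicalSpace_eq (mkPseudoEMetric (limitSeminorm L ψ))
      (isLipschitzSeminorm_limitSeminorm hL hψ).eq_of_mkDist_eq_zero fun ν => ?_
    have h := (continuous_limitDist (ψ := ψ) hL ν).tendsto ν
    rw [limitDist_self] at h
    exact tendsto_of_tendsto_of_tendsto_of_le_of_le tendsto_const_nhds h (fun _ => zero_le)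
      fun μ => mkDist_limitSeminorm_le μ ν

end LimitSeminorm

theorem theorem3p6 {A : ℕ → Type u} [∀ n, CStarAlgebra (A n)]
    (L : ∀ n, A n → ℝ≥0∞) (hL : ∀ n, IsLipNorm (L n))
    (φ : ∀ n, A n →⋆ₐ[ℂ] A (n + 1))
    (hφ : ∀ n a, L n a < ∞ → L (n + 1) (φ n a) < ∞)
    {B : Type v} [CStarAlgebra B] (ψ : ∀ n, A n →⋆ₐ[ℂ] B) (hψ : IsInductiveLimit φ ψ) :
    IsLipNorm (limitSeminorm L ψ) :=
  isLipNorm_limitSeminorm hL hψ.dense_iUnion_range
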